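/- Let $\mathbb F$ be a finite field and let $r,m\ge 1$ be integers. Upper indices $(k)$ are computed modulo $r$, and $\delta$ is the Kronecker delta (for upper indices modulo $r$). \emph{The category $\mathcal C(r,m)$.} Let $\Gamma$ be the quiver with vertices $X_{i,j}^{(k)}$ ($k\in[1,r]$, $i,j\in\mathbb Z$, $i\le j$) and $Z_i^{(k)}$ ($k\in[1,r]$, $i\in\mathbb Z$), and with the following arrows, each with a degree: * $X_{i,j}^{(k)}\to X_{s,t}^{(k)}$ of degree $0$, for $i\le s\le j\le t$; * $X_{i,j}^{(k)}\to Z_s^{(k)}$ of degree $1$, for $i\le s\le j$; * $X_{i,j}^{(k)}\to X_{s,t}^{(k+1)}$ of degree $2$, for $s\le i+\delta_{k,r}m-1\le t\le j+\delta_{k,r}m-1$; * $Z_i^{(k)}\to Z_s^{(k)}$ of degree $0$, for $s\ge i$; * $Z_i^{(k)}\to X_{s,t}^{(k+1)}$ of degree $1$, for $s\le i+\delta_{k,r}m-1\le t$. The objects of the $\mathbb F$-linear category $\mathcal C=\mathcal C(r,m)$ are the formal finite direct sums of vertices of $\Gamma$. The morphisms between vertices are the $\mathbb F$-linear combinations of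 paths modulo the ideal generated by the following relations: the degree $0$ arrow from a vertex to itself is the identity; and if $f\colon U\to V$, $g\colon V\to W$ are arrows of degrees $d,d'$, then $g\circ f$ is the arrow $U\to W$ of degree $d+d'$ if there is one, and $g\circ f=0$ otherwise. Assume that $\mathcal C$ is equipped with a triangulated structure whose suspension functor $\Sigma$ satisfies $$\Sigma X_{i,j}^{(k)}\simeq X_{i+\delta_{k,r}m,\,j+\delta_{k,r}m}^{(k+1)},\qquad \Sigma Z_i^{(k)}\simeq Z_{i+\delta_{k,r}m}^{(k+1)}.$$ \emph{Dimension vectors.} For a set $I$ let $\mathbb N^{(I)}$ be the set of finitely supported families of nonnegative integers, ordered componentwise. Define $\mathbf{dim}_{\mathcal Z}M\in\mathbb N^{([1,r])}$ and $\mathbf{dim}_{\mathcal X}M\in\mathbb N^{([1,r]\times\mathbb Z)}$, additively on direct sums, by putting, for a vertex $M$: * $(\mathbf{dim}_{\mathcal Z}M)(k)=1$ if $M=Z_s^{(k)}$ for some $s$, and $0$ otherwise; * $(\mathbf{dim}_{\mathcal X}M)(k,i)=1$ if $M=X_{s,t}^{(k)}$ with $s\le i\le t$, or $i<0$ and $M=Z_s^{(k)}$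 with $s\le i$, or $i\ge\delta_{k,1}m$ and $M=Z_s^{(k-1)}$ with $s\ge i-\delta_{k,1}m+1$; and $0$ otherwise. Pairs of vectors are compared by: $(d_1,d_2)\le(d_1',d_2')$ if $d_1<d_1'$, or $d_1=d_1'$ and $d_2\le d_2'$. A pair $(\mathbf d_1,\mathbf d_2)$ of functions from the objects of a triangulated category to $\mathbb N^{(I)}$ and $\mathbb N^{(J)}$ is called subadditive if $(\mathbf d_1M,\mathbf d_2M)=0$ exactly when $M=0$ (i.e. $M$ is a zero object), and $$(\mathbf d_1L,\mathbf d_2L)\le(\mathbf d_1M,\mathbf d_2M)+(\mathbf d_1N,\mathbf d_2N)$$ for every exact triangle $M\to L\to N\to\Sigma M$; a single function $\mathbf d_2$ is called subadditive if this holds with $I=\emptyset$. \textbf{Statement.} 1. The pair $(\mathbf{dim}_{\mathcal Z},\mathbf{dim}_{\mathcal X})$ is a subadditive pair of functions on $\mathcal C(r,m)$. 2. The full additive subcategory $\mathcal X(r,m)$ of $\mathcal C(r,m)$ formed by the direct sums of vertices $X_{i,j}^{(k)}$ is a triangulated subcategory of $\mathcal C(r,m)$, and the restriction of $\mathbf{dim}_{\mathcal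 X}$ to $\mathcal X(r,m)$ is a subadditive function. -/

import Mathlib

open CategoryTheory CategoryTheory.Limits CategoryTheory.Pretriangulated

universe u

namespace DiscreteDerived

/-! ### The quiver with degrees -/

/-- The vertices of the quiver `Γ` for the parameters `r`, `m`: the vertices `X_{i,j}^{(k)}` with
`i ≤ j`, and the vertices `Z_i^{(k)}`. The upper index is computed modulo `r`, so it is an element
of `ZMod r`, the class `0` being the upper index `r`. The field `F` and the number `m` are
recorded in the type since the morphisms between vertices depend on them. -/
inductive Vertex (F : Type u) (r m : ℕ) : Type
  | X (k : ZMod r) (i j : ℤ) (hij : i ≤ j) : Vertex F r m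
  | Z (k : ZMod r) (i : ℤ) : Vertex F r m

/-- The number `δ_{k,r} m` (in `ZMod r` one has `r = 0`). -/
def deltaR {r : ℕ} (m : ℕ) (k : ZMod r) : ℤ := if k = 0 then (m : ℤ) else 0

/-- The number `δ_{k,1} m`. -/
def deltaOne {r : ℕ} (m : ℕ) (k : ZMod r) : ℤ := if k = 1 then (m : ℤ) else 0

variable {F : Type u} {r m : ℕ}

/-- `HasArrow V W d`: there is an arrow of degree `d` from `V` to `W` in `Γ`. There is at most one
arrow of each degree between two vertices. The five non-trivial cases are, in this order, the
arrows `α` (degree `0`), `γ` (degree `2`), `β` (degree `1`), `α'` (degree `0`) and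
`β'` (degree `1`). -/
def HasArrow : Vertex F r m → Vertex F r m → ℕ → Prop
  | .X k i j _, .X l s t _, 0 => l = k ∧ (i ≤ s ∧ s ≤ j) ∧ j ≤ t
  | .X k i j _, .X l s t _, 2 =>
      l = k + 1 ∧ s ≤ i + deltaR m k - 1 ∧
        (i + deltaR m k - 1 ≤ t ∧ t ≤ j + deltaR m k - 1)
  | .X k i j _, .Z l s, 1 => l = k ∧ (i ≤ s ∧ s ≤ j)
  | .Z k i, .Z l s, 0 => l = k ∧ i ≤ s
  | .Z k i, .X l s t _, 1 => l = k + 1 ∧ s ≤ i + deltaR m k - 1 ∧ i + deltaR m k - 1 ≤ t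
  | _, _, _ => False

theorem hasArrow_refl (V : Vertex F r m) : HasArrow V V 0 := by
  cases V <;> simp [HasArrow, *]

/-- The multiplication rule for arrows is associative: if the product of three composable arrows
can be nonzero, then so can the two partial products. -/
theorem HasArrow.le_two {V W : Vertex F r m} {d : ℕ} (h : HasArrow V W d) : d ≤ 2 := by
  match V, W, d, h with
  | .X _ _ _ _, .X _ _ _ _, 0, _ => omega
  | .X _ _ _ _, .X _ _ _ _, 2, _ => omega
  | .X _ _ _ _, .Z _ _, 1, _ => omega
  | .Z _ _, .Z _ _, 0, _ => omega
  | .Z _ _, .X _ _ _ _, 1, _ => omega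

/-- The multiplication rule for arrows is associative: if the product of three composable arrows
can be nonzero, then so can the two partial products. -/
theorem hasArrow_factor {A B C D : Vertex F r m} {a b c : ℕ} (hf : HasArrow A B a)
    (hg : HasArrow B C b) (hh : HasArrow C D c) (h : HasArrow A D (a + b + c)) :
    HasArrow A C (a + b) ∧ HasArrow B D (b + c) := by
  have h2 := h.le_two
  obtain ⟨ha, hb, hc⟩ : a ≤ 2 ∧ b ≤ 2 ∧ c ≤ 2 := by omega
  interval_cases a <;> interval_cases b <;> interval_cases c <;> first | omega | skip
  all_goals
    cases A <;> cases B <;> cases C <;> cases D <;>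
      simp only [HasArrow, Nat.reduceAdd] at hf hg hh h ⊢ <;>
      grind

/-! ### Dimension vectors of vertices -/

/-- The vector `dim_Z` of a vertex. -/
noncomputable def Vertex.dimZ : Vertex F r m → (ZMod r →₀ ℕ)
  | .X _ _ _ _ => 0
  | .Z k _ => Finsupp.single k 1

open Classical in
/-- The entries of the vector `dim_X` of a vertex. -/
noncomputable def Vertex.dimXEntry : Vertex F r m → ZMod r × ℤ → ℕ
  | .X l s t _, (k, i) => if l = k ∧ s ≤ i ∧ i ≤ t then 1 else 0
  | .Z l s, (k, i) =>
      if (i < 0 ∧ l = k ∧ s ≤ i) ∨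
          (deltaOne m k ≤ i ∧ l = k - 1 ∧ i - deltaOne m k + 1 ≤ s) then 1 else 0

theorem Vertex.dimXEntry_finite (V : Vertex F r m) : (Function.support V.dimXEntry).Finite := by
  cases V with
  | X l s t hst =>
    refine ((Set.finite_singleton l).prod (Set.finite_Icc s t)).subset ?_
    rintro ⟨k, i⟩ h
    simp only [Function.mem_support, Vertex.dimXEntry, ne_eq, ite_eq_right_iff, one_ne_zero,
      imp_false, not_not] at h
    exact ⟨h.1.symm, h.2⟩
  | Z l s =>
    refine (((Set.finite_singleton l).union (Set.finite_singleton (l + 1))).prod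
      ((Set.finite_Ico s 0).union (Set.finite_Icc 0 (s + m)))).subset ?_
    rintro ⟨k, i⟩ h
    simp only [Function.mem_support, Vertex.dimXEntry, ne_eq, ite_eq_right_iff, one_ne_zero,
      imp_false, not_not] at h
    rcases h with ⟨h1, h2, h3⟩ | ⟨h1, h2, h3⟩
    · exact ⟨Or.inl h2.symm, Or.inl ⟨h3, h1⟩⟩
    · refine ⟨Or.inr (by simp [h2]), Or.inr ?_⟩
      have : 0 ≤ deltaOne m k ∧ deltaOne m k ≤ m := by
        unfold deltaOne
        split_ifs <;> omega
      constructor <;> omega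

/-- The vector `dim_X` of a vertex. -/
noncomputable def Vertex.dimX (V : Vertex F r m) : ZMod r × ℤ →₀ ℕ :=
  Finsupp.ofSupportFinite V.dimXEntry V.dimXEntry_finite

/-! ### The category `C(r, m)` -/

variable [Field F]

/-- The space of morphisms between two vertices in the path category of `Γ` over `F` modulo the
relations: `F`-linear combinations of the arrows `V → W`. A morphism is recorded by the family of
its coefficients, the coefficient at `d` being the one of the arrow of degree `d`.

By the relations (`α_{(i,j),(i,j)}` and `α'_{i,i}` are identities, and the product of two
composable arrows is the arrow with the same end points whose degree is the sum of the two degrees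
if there is one, and is zero otherwise) each path equals an arrow or zero. Since this multiplication
rule is associative (`hasArrow_factor`), the arrows form a basis of the path category modulo
the relations. -/
def homSpace (V W : Vertex F r m) : Submodule F (ℕ → F) where
  carrier := {f | ∀ d, ¬ HasArrow V W d → f d = 0}
  add_mem' := by
    intro f g hf hg d hd
    simp [hf d hd, hg d hd]
  zero_mem' := by
    intro d _
    rfl
  smul_mem' := by
    intro c f hf d hd
    simp [hf d hd]

open Classical in
/-- The bilinear extension of the multiplication rule for arrows. -/
noncomputable def homComp {U V W : Vertex F r m} (f : homSpace U V) (g : homSpace V W) :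
    homSpace U W :=
  ⟨fun n => if HasArrow U W n then
      ∑ p ∈ Finset.HasAntidiagonal.antidiagonal n, f.1 p.1 * g.1 p.2 else 0,
    fun _ hd => if_neg hd⟩

open Classical in
/-- The identity of a vertex: the arrow of degree `0` from the vertex to itself. -/
noncomputable def homId (V : Vertex F r m) : homSpace V V :=
  ⟨Pi.single 0 1, fun d hd => by
    have : d ≠ 0 := by
      rintro rfl
      exact hd (hasArrow_refl V)
    simp [this]⟩

theorem homComp_assoc {A B C D : Vertex F r m} (f : homSpace A B) (g : homSpace B C)
    (h : homSpace C D) : homComp (homComp f g) h = homComp f (homComp g h) := by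
  classical
  ext n
  simp only [homComp]
  split_ifs with hn
  · have key : ∀ p ∈ Finset.HasAntidiagonal.antidiagonal n,
        (if HasArrow A C p.1 then ∑ q ∈ Finset.HasAntidiagonal.antidiagonal p.1, f.1 q.1 * g.1 q.2 else 0) * h.1 p.2
          = (∑ q ∈ Finset.HasAntidiagonal.antidiagonal p.1, f.1 q.1 * g.1 q.2) * h.1 p.2 := by
      intro p hp
      split_ifs with hA
      · rfl
      · rw [zero_mul, Finset.sum_mul]
        symm
        refine Finset.sum_eq_zero fun q hq => ?_
        by_contra hne
        rw [Finset.HasAntidiagonal.mem_antidiagonal] at hp hq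
        have h1 : HasArrow A B q.1 := by
          by_contra hc
          exact hne (by rw [f.2 _ hc]; simp)
        have h2 : HasArrow B C q.2 := by
          by_contra hc
          exact hne (by rw [g.2 _ hc]; simp)
        have h3 : HasArrow C D p.2 := by
          by_contra hc
          exact hne (by rw [h.2 _ hc]; simp)
        exact hA (hq ▸ (hasArrow_factor h1 h2 h3 (by rw [hq, hp]; exact hn)).1)
    have key' : ∀ p ∈ Finset.HasAntidiagonal.antidiagonal n,
        f.1 p.1 * (if HasArrow B D p.2 then ∑ q ∈ Finset.HasAntidiagonal.antidiagonal p.2, g.1 q.1 * h.1 q.2 else 0)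
          = f.1 p.1 * (∑ q ∈ Finset.HasAntidiagonal.antidiagonal p.2, g.1 q.1 * h.1 q.2) := by
      intro p hp
      split_ifs with hA
      · rfl
      · rw [mul_zero, Finset.mul_sum]
        symm
        refine Finset.sum_eq_zero fun q hq => ?_
        by_contra hne
        rw [Finset.HasAntidiagonal.mem_antidiagonal] at hp hq
        have h1 : HasArrow A B p.1 := by
          by_contra hc
          exact hne (by rw [f.2 _ hc]; simp)
        have h2 : HasArrow B C q.1 := by
          by_contra hc
          exact hne (by rw [g.2 _ hc]; simp)
        have h3 : HasArrow C D q.2 := by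
          by_contra hc
          exact hne (by rw [h.2 _ hc]; simp)
        exact hA (hq ▸ (hasArrow_factor h1 h2 h3 (by rw [add_assoc, hq, hp]; exact hn)).2)
    rw [Finset.sum_congr rfl key, Finset.sum_congr rfl key']
    have := congrArg (PowerSeries.coeff n)
      (mul_assoc (PowerSeries.mk f.1) (PowerSeries.mk g.1) (PowerSeries.mk h.1))
    simpa only [PowerSeries.coeff_mul, PowerSeries.coeff_mk] using this
  · rfl

theorem homId_comp {V W : Vertex F r m} (f : homSpace V W) : homComp (homId V) f = f := by
  classical
  ext n
  simp only [homComp, homId]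
  split_ifs with hn
  · rw [Finset.sum_eq_single (0, n)]
    · simp
    · rintro ⟨a, b⟩ hp hne
      have : a ≠ 0 := by
        rintro rfl
        simp at hp
        exact hne (by simp [hp])
      simp [this]
    · simp
  · exact (f.2 n hn).symm

theorem homComp_id {V W : Vertex F r m} (f : homSpace V W) : homComp f (homId W) = f := by
  classical
  ext n
  simp only [homComp, homId]
  split_ifs with hn
  · rw [Finset.sum_eq_single (n, 0)]
    · simp
    · rintro ⟨a, b⟩ hp hne
      have : b ≠ 0 := by
        rintro rfl
        simp at hp
        exact hne (by simp [hp])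
      simp [this]
    · simp
  · exact (f.2 n hn).symm

/-- The full subcategory of `C(r, m)` on the vertices of `Γ`. -/
noncomputable instance : Category.{u} (Vertex F r m) where
  Hom V W := homSpace V W
  id V := homId V
  comp f g := homComp f g
  id_comp := homId_comp
  comp_id := homComp_id
  assoc := homComp_assoc

theorem add_homComp {U V W : Vertex F r m} (f f' : homSpace U V) (g : homSpace V W) :
    homComp (f + f') g = homComp f g + homComp f' g := by
  ext n
  simp only [homComp, Submodule.coe_add, Pi.add_apply]
  split_ifs
  · simp only [add_mul, Finset.sum_add_distrib]
  · simp

theorem homComp_add {U V W : Vertex F r m} (f : homSpace U V) (g g' : homSpace V W) :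
    homComp f (g + g') = homComp f g + homComp f g' := by
  ext n
  simp only [homComp, Submodule.coe_add, Pi.add_apply]
  split_ifs
  · simp only [mul_add, Finset.sum_add_distrib]
  · simp

theorem smul_homComp {U V W : Vertex F r m} (c : F) (f : homSpace U V) (g : homSpace V W) :
    homComp (c • f) g = c • homComp f g := by
  ext n
  simp only [homComp, Submodule.coe_smul, Pi.smul_apply, smul_eq_mul]
  split_ifs
  · simp only [mul_assoc, Finset.mul_sum]
  · simp

theorem homComp_smul {U V W : Vertex F r m} (f : homSpace U V) (c : F) (g : homSpace V W) :
    homComp f (c • g) = c • homComp f g := by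
  ext n
  simp only [homComp, Submodule.coe_smul, Pi.smul_apply, smul_eq_mul]
  split_ifs
  · simp only [mul_left_comm _ c, Finset.mul_sum]
  · simp

noncomputable instance : Preadditive (Vertex F r m) where
  homGroup V W := inferInstanceAs (AddCommGroup (homSpace V W))
  add_comp _ _ _ f f' g := add_homComp f f' g
  comp_add _ _ _ f g g' := homComp_add f g g'

noncomputable instance : Linear F (Vertex F r m) where
  homModule V W := inferInstanceAs (Module F (homSpace V W))
  smul_comp _ _ _ c f g := smul_homComp c f g
  comp_smul _ _ _ f c g := homComp_smul f c g

open Classical in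
/-- The arrow of degree `d` from `V` to `W`, as a morphism. -/
noncomputable def arrow {V W : Vertex F r m} {d : ℕ} (h : HasArrow V W d) : V ⟶ W :=
  (⟨Pi.single d 1, fun e he => by
    have : e ≠ d := by
      rintro rfl
      exact he h
    simp [this]⟩ : homSpace V W)

theorem arrow_refl (V : Vertex F r m) : arrow (hasArrow_refl V) = 𝟙 V := rfl

open Classical in
/-- The defining relations for the products of arrows. -/
theorem arrow_comp_arrow {U V W : Vertex F r m} {d e : ℕ} (h : HasArrow U V d)
    (h' : HasArrow V W e) :
    arrow h ≫ arrow h' = if h'' : HasArrow U W (d + e) then arrow h'' else 0 := by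
  have key : ∀ n, ∑ p ∈ Finset.HasAntidiagonal.antidiagonal n,
      (Pi.single d 1 : ℕ → F) p.1 * (Pi.single e 1 : ℕ → F) p.2
        = (Pi.single (d + e) 1 : ℕ → F) n := by
    intro n
    by_cases hn : n = d + e
    · subst hn
      rw [Finset.sum_eq_single (d, e)]
      · simp
      · rintro ⟨a, b⟩ hp hne
        by_cases ha : a = d
        · have hb : b ≠ e := by
            rintro rfl
            exact hne (by rw [ha])
          simp [hb]
        · simp [ha]
      · simp
    · rw [Pi.single_eq_of_ne hn]
      refine Finset.sum_eq_zero ?_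
      rintro ⟨a, b⟩ hp
      rw [Finset.HasAntidiagonal.mem_antidiagonal] at hp
      by_cases ha : a = d
      · have hb : b ≠ e := by
          rintro rfl
          exact hn (by rw [← hp, ha])
        simp [hb]
      · simp [ha]
  refine Subtype.ext (funext fun n => ?_)
  change (if HasArrow U W n then ∑ p ∈ Finset.HasAntidiagonal.antidiagonal n,
      (Pi.single d 1 : ℕ → F) p.1 * (Pi.single e 1 : ℕ → F) p.2 else 0) = _
  rw [key]
  split_ifs with hn h'' h''
  · rfl
  · have : n ≠ d + e := by
      rintro rfl
      exact h'' hn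
    rw [Pi.single_eq_of_ne this]
    rfl
  · have : n ≠ d + e := by
      rintro rfl
      exact hn h''
    exact (Pi.single_eq_of_ne (M := fun _ => F) this 1).symm
  · rfl

variable (F r m) in
/-- The category `C(r, m)` over the field `F`: its objects are the formal finite direct sums of
vertices of `Γ`, its morphisms are the matrices of morphisms between vertices. -/
abbrev CatC : Type 1 := Mat_ (Vertex F r m)

/-- The indecomposable object `X_{i,j}^{(k)}` of `C(r, m)`. -/
noncomputable abbrev objX (F : Type u) [Field F] {r : ℕ} (m : ℕ) (k : ZMod r) (i j : ℤ) (hij : i ≤ j) :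
    CatC F r m :=
  (Mat_.embedding (Vertex F r m)).obj (.X k i j hij)

/-- The indecomposable object `Z_i^{(k)}` of `C(r, m)`. -/
noncomputable abbrev objZ (F : Type u) [Field F] {r : ℕ} (m : ℕ) (k : ZMod r) (i : ℤ) : CatC F r m :=
  (Mat_.embedding (Vertex F r m)).obj (.Z k i)

/-- The suspension of a triangulated structure on `C(r, m)` acts on the indecomposable objects by
`Σ X_{i,j}^{(k)} = X_{i + δ_{k,r} m, j + δ_{k,r} m}^{(k+1)}` and
`Σ Z_i^{(k)} = Z_{i + δ_{k,r} m}^{(k+1)}` (up to isomorphism). -/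
def IsStandardShift (F : Type u) [Field F] (r m : ℕ) [HasShift (CatC F r m) ℤ] : Prop :=
  (∀ (k : ZMod r) (i j : ℤ) (hij : i ≤ j),
    Nonempty ((objX F m k i j hij)⟦(1 : ℤ)⟧ ≅
      objX F m (k + 1) (i + deltaR m k) (j + deltaR m k) (by omega))) ∧
  ∀ (k : ZMod r) (i : ℤ),
    Nonempty ((objZ F m k i)⟦(1 : ℤ)⟧ ≅ objZ F m (k + 1) (i + deltaR m k))

/-! ### Dimension vectors of objects -/

/-- The vector `dim_Z` on `C(r, m)`, the additive extension of its values on the vertices. -/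
noncomputable def dimZ (M : CatC F r m) : ZMod r →₀ ℕ := ∑ a, (M.X a).dimZ

/-- The vector `dim_X` on `C(r, m)`, the additive extension of its values on the vertices. -/
noncomputable def dimX (M : CatC F r m) : ZMod r × ℤ →₀ ℕ := ∑ a, (M.X a).dimX

/-- `X(r, m)`: the formal direct sums of vertices of the form `X_{i,j}^{(k)}`. -/
def catX (F : Type u) [Field F] (r m : ℕ) : ObjectProperty (CatC F r m) :=
  fun M => ∀ a, ∃ k i j hij, M.X a = .X k i j hij

/-! ### Subadditivity -/

/-- The order on pairs of vectors: lexicographic, and componentwise in each of the two vectors. -/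
def PairLE {I J : Type*} (d d' : (I →₀ ℕ) × (J →₀ ℕ)) : Prop :=
  d.1 < d'.1 ∨ (d.1 = d'.1 ∧ d.2 ≤ d'.2)

/-- `(d₁, d₂)` is a subadditive pair of functions on the triangulated category `T`. -/
structure IsSubadditivePair {T : Type*} [Category T] [Preadditive T] [HasZeroObject T]
    [HasShift T ℤ] [∀ n : ℤ, (shiftFunctor T n).Additive] [Pretriangulated T] {I J : Type*}
    (d₁ : T → (I →₀ ℕ)) (d₂ : T → (J →₀ ℕ)) : Prop where
  eq_zero_iff : ∀ M : T, (d₁ M, d₂ M) = 0 ↔ IsZero M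
  le_add : ∀ S ∈ distTriang T,
    PairLE (d₁ S.obj₂, d₂ S.obj₂) ((d₁ S.obj₁, d₂ S.obj₁) + (d₁ S.obj₃, d₂ S.obj₃))

/-- `d` is a subadditive function on the triangulated category `T`. -/
structure IsSubadditive {T : Type*} [Category T] [Preadditive T] [HasZeroObject T]
    [HasShift T ℤ] [∀ n : ℤ, (shiftFunctor T n).Additive] [Pretriangulated T] {J : Type*}
    (d : T → (J →₀ ℕ)) : Prop where
  eq_zero_iff : ∀ M : T, d M = 0 ↔ IsZero M
  le_add : ∀ S ∈ distTriang T, d S.obj₂ ≤ d S.obj₁ + d S.obj₃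

end DiscreteDerived

/-! Write q = |F|. Each entry of the dimension vectors is the logarithm to base q of the size of a
group of morphisms to or from a vertex Z, and half-exact functors with finite values are
submultiplicative in size along exact triangles. The entry `dimZ` at k is the dimension of Hom(-,
Z_j^{(k)}) for j large. The entry `dimX` at (k, i) is the dimension of Hom(-, Z_i^{(k)}) for i < 0,
and of Hom(Z_{i-δ+1}^{(k-1)}, -) for i ≥ δ, where δ = δ_{k,1} m. In the gap 0 ≤ i < δ it is the
dimension of the kernel of Hom(-, Z_i^{(k)}) → Hom(-, Z_j^{(k)}), with j large. Outside the gap, Hom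
is half-exact and subadditivity is immediate. The kernel functor is half-exact only on triangles M →
L → N for which Hom(N, Z_j) → Hom(L, Z_j) is injective. This is why the pair is ordered
lexicographically: if the `dimZ` inequality is an equality, the count for Z_j is sharp, and
sharpness forces this injectivity (`card_hom_to_le`, `card_ker_rightComp_le`). The objects of X(r,
m) are those with no nonzero morphism to Z_j^{(k)} for j large. Shifts only translate j, and
extensions are controlled by `dimZ_le_add`. -/

/-! ### Counting in exact sequences of finite groups -/

theorem AddMonoidHom.card_le_mul_of_ker_le_range {A B C : Type*} [AddCommGroup A] [AddCommGroup B]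
    [AddCommGroup C] [Finite A] [Finite B] [Finite C] (f : A →+ B) (g : B →+ C)
    (h : g.ker ≤ f.range) :
    Nat.card B ≤ Nat.card A * Nat.card C ∧
      (Nat.card B = Nat.card A * Nat.card C → Function.Injective f) := by
  have hB : Nat.card B = Nat.card g.range * Nat.card g.ker := by
    rw [← Nat.card_congr (QuotientAddGroup.quotientKerEquivRange g).toEquiv]
    exact AddSubgroup.card_eq_card_quotient_mul_card_addSubgroup g.ker
  have hker : Nat.card g.ker ≤ Nat.card f.range :=
    Nat.card_le_card_of_injective _ (AddSubgroup.inclusion_injective h)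
  have hf : Nat.card f.range ≤ Nat.card A :=
    Nat.card_le_card_of_surjective _ f.rangeRestrict_surjective
  have hg : Nat.card g.range ≤ Nat.card C :=
    Nat.card_le_card_of_injective _ Subtype.val_injective
  refine ⟨?_, fun heq => ?_⟩
  · rw [hB, mul_comm]
    exact Nat.mul_le_mul (hker.trans hf) hg
  · have hC : 0 < Nat.card C := Nat.card_pos
    have hle : Nat.card A ≤ Nat.card f.range := by
      refine Nat.le_of_mul_le_mul_right ?_ hC
      rw [← heq, hB, mul_comm]
      exact Nat.mul_le_mul hker hg
    have hbij := (Nat.bijective_iff_surjective_and_card f.rangeRestrict).2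
      ⟨f.rangeRestrict_surjective, le_antisymm hle hf⟩
    exact AddMonoidHom.rangeRestrict_injective_iff.1 hbij.1

/-! ### Half-exactness of Hom on triangles, in terms of cardinalities -/

namespace CategoryTheory.Pretriangulated

variable {C : Type*} [Category* C] [HasZeroObject C] [HasShift C ℤ] [Preadditive C]
  [∀ n : ℤ, (shiftFunctor C n).Additive] [Pretriangulated C] [∀ X Y : C, Finite (X ⟶ Y)]

/-- The equality clause supplies the injectivity hypothesis of `card_ker_rightComp_le`. -/
theorem card_hom_to_le (T : Triangle C) (hT : T ∈ distTriang C) (Y : C) :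
    Nat.card (T.obj₂ ⟶ Y) ≤ Nat.card (T.obj₃ ⟶ Y) * Nat.card (T.obj₁ ⟶ Y) ∧
      (Nat.card (T.obj₂ ⟶ Y) = Nat.card (T.obj₃ ⟶ Y) * Nat.card (T.obj₁ ⟶ Y) →
        ∀ f : T.obj₃ ⟶ Y, T.mor₂ ≫ f = 0 → f = 0) := by
  obtain ⟨h₁, h₂⟩ := AddMonoidHom.card_le_mul_of_ker_le_range
    (Preadditive.leftComp Y T.mor₂) (Preadditive.leftComp Y T.mor₁) (by
      intro f hf
      obtain ⟨g, hg⟩ := Triangle.yoneda_exact₂ T hT f hf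
      exact ⟨g, hg.symm⟩)
  exact ⟨h₁, fun h => (injective_iff_map_eq_zero _).1 (h₂ h)⟩

theorem card_hom_from_le (T : Triangle C) (hT : T ∈ distTriang C) (Y : C) :
    Nat.card (Y ⟶ T.obj₂) ≤ Nat.card (Y ⟶ T.obj₁) * Nat.card (Y ⟶ T.obj₃) :=
  (AddMonoidHom.card_le_mul_of_ker_le_range
    (Preadditive.rightComp Y T.mor₁) (Preadditive.rightComp Y T.mor₂) (by
      intro f hf
      obtain ⟨g, hg⟩ := Triangle.coyoneda_exact₂ T hT f hf
      exact ⟨g, hg.symm⟩)).1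

/-- The morphisms from `X` killed by `v` form a half-exact functor of `X` on the triangles whose
second morphism induces a monomorphism on the morphisms to the target of `v`. -/
theorem card_ker_rightComp_le (T : Triangle C) (hT : T ∈ distTriang C) {Y Y' : C} (v : Y ⟶ Y')
    (hinj : ∀ f : T.obj₃ ⟶ Y', T.mor₂ ≫ f = 0 → f = 0) :
    Nat.card (Preadditive.rightComp T.obj₂ v).ker ≤
      Nat.card (Preadditive.rightComp T.obj₃ v).ker *
        Nat.card (Preadditive.rightComp T.obj₁ v).ker := by
  have hmap : ∀ {A B : C} (w : A ⟶ B) (f : B ⟶ Y), f ∈ (Preadditive.rightComp B v).ker →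
      w ≫ f ∈ (Preadditive.rightComp A v).ker := by
    intro A B w f hf
    change (w ≫ f) ≫ v = 0
    rw [Category.assoc, show f ≫ v = 0 from hf, comp_zero]
  refine (AddMonoidHom.card_le_mul_of_ker_le_range
    (((Preadditive.leftComp Y T.mor₂).comp (AddSubgroup.subtype _)).codRestrict _
      fun f => hmap _ _ f.2)
    (((Preadditive.leftComp Y T.mor₁).comp (AddSubgroup.subtype _)).codRestrict _
      fun f => hmap _ _ f.2) ?_).1
  rintro ⟨f, hfv⟩ hf
  -- Exactness yields a factorization f = T.mor₂ ≫ g, but g must also be killed by v. Since T.mor₂ ≫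
  -- g ≫ v = f ≫ v = 0, this is where `hinj` is needed.
  obtain ⟨g, hg⟩ := Triangle.yoneda_exact₂ T hT f (congrArg Subtype.val hf)
  refine ⟨⟨g, hinj _ ?_⟩, Subtype.ext hg.symm⟩
  change T.mor₂ ≫ g ≫ v = 0
  rw [← Category.assoc, ← hg]
  exact hfv

end CategoryTheory.Pretriangulated

/-! ### Morphisms between formal direct sums and single vertices -/

namespace CategoryTheory.Mat_

variable {C : Type*} [Category* C] [Preadditive C]

/-- Morphisms to an object of `C` are families of morphisms. -/
def homEmbeddingEquiv (M : Mat_ C) (Y : C) :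
    (M ⟶ (embedding C).obj Y) ≃ ∀ a, M.X a ⟶ Y where
  toFun f a := f a PUnit.unit
  invFun f a _ := f a
  left_inv _ := rfl
  right_inv _ := rfl

/-- Morphisms from an object of `C` are families of morphisms. -/
def embeddingHomEquiv (M : Mat_ C) (Y : C) :
    ((embedding C).obj Y ⟶ M) ≃ ∀ a, Y ⟶ M.X a where
  toFun f a := f PUnit.unit a
  invFun f _ a := f a
  left_inv _ := rfl
  right_inv _ := rfl

theorem homEmbeddingEquiv_comp {M : Mat_ C} {Y Y' : C} (f : M ⟶ (embedding C).obj Y) (v : Y ⟶ Y')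
    (a : M.ι) :
    homEmbeddingEquiv M Y' (f ≫ (embedding C).map v) a = homEmbeddingEquiv M Y f a ≫ v :=
  (comp_apply f ((embedding C).map v) a PUnit.unit).trans (Fintype.sum_unique (ι := PUnit) _)

theorem card_hom_embedding (M : Mat_ C) (Y : C) :
    Nat.card (M ⟶ (embedding C).obj Y) = ∏ a, Nat.card (M.X a ⟶ Y) := by
  rw [Nat.card_congr (homEmbeddingEquiv M Y), Nat.card_pi]

theorem card_embedding_hom (M : Mat_ C) (Y : C) :
    Nat.card ((embedding C).obj Y ⟶ M) = ∏ a, Nat.card (Y ⟶ M.X a) := by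
  rw [Nat.card_congr (embeddingHomEquiv M Y), Nat.card_pi]

theorem card_ker_rightComp_embedding (M : Mat_ C) {Y Y' : C} (v : Y ⟶ Y') :
    Nat.card (Preadditive.rightComp M ((embedding C).map v)).ker =
      ∏ a, Nat.card (Preadditive.rightComp (M.X a) v).ker := by
  rw [← Nat.card_pi]
  refine Nat.card_congr (((homEmbeddingEquiv M Y).subtypeEquiv fun f => ?_).trans
    (Equiv.subtypePiEquivPi (p := fun a g => g ∈ (Preadditive.rightComp (M.X a) v).ker)))
  refine (homEmbeddingEquiv M Y').injective.eq_iff.symm.trans (funext_iff.trans ?_)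
  exact forall_congr' fun a => by
    change homEmbeddingEquiv M Y' (f ≫ (embedding C).map v) a = 0 ↔ _
    rw [homEmbeddingEquiv_comp]
    rfl

instance [∀ X Y : C, Finite (X ⟶ Y)] (M N : Mat_ C) : Finite (M ⟶ N) :=
  inferInstanceAs (Finite (∀ a b, M.X a ⟶ N.X b))

end CategoryTheory.Mat_

/-! ### Entries of dimension vectors as exponents: vertices -/

namespace DiscreteDerived

variable {F : Type u} {r m : ℕ}

theorem deltaR_sub_one (k : ZMod r) : deltaR m (k - 1) = deltaOne m k := by
  simp [deltaR, deltaOne, sub_eq_zero]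

theorem deltaOne_nonneg (k : ZMod r) : 0 ≤ deltaOne m k := by
  unfold deltaOne
  split_ifs <;> omega

/-- The degree of the arrows from `V` to the vertices `Z`. -/
def Vertex.degToZ : Vertex F r m → ℕ
  | .X _ _ _ _ => 1
  | .Z _ _ => 0

/-- The degree of the arrows from the vertices `Z` to `V`. -/
def Vertex.degFromZ : Vertex F r m → ℕ
  | .X _ _ _ _ => 1
  | .Z _ _ => 0

/-- Only one degree can occur, so morphism spaces from V to a vertex Z have dimension at most one
and the counts below are 1 or q. -/
theorem HasArrow.eq_degToZ {V : Vertex F r m} {k : ZMod r} {i : ℤ} {e : ℕ}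
    (h : HasArrow V (.Z k i) e) : e = V.degToZ := by
  match V, e, h with
  | .X _ _ _ _, 1, _ => rfl
  | .Z _ _, 0, _ => rfl

theorem HasArrow.eq_degFromZ {V : Vertex F r m} {k : ZMod r} {i : ℤ} {e : ℕ}
    (h : HasArrow (.Z k i) V e) : e = V.degFromZ := by
  match V, e, h with
  | .X _ _ _ _, 1, _ => rfl
  | .Z _ _, 0, _ => rfl

theorem hasArrow_Z_Z {k : ZMod r} {i j : ℤ} (h : i ≤ j) :
    HasArrow (.Z k i : Vertex F r m) (.Z k j) 0 := ⟨rfl, h⟩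

theorem dimX_apply (M : CatC F r m) (p : ZMod r × ℤ) :
    dimX M p = ∑ a, (M.X a).dimXEntry p :=
  Finsupp.finsetSum_apply _ _ _

theorem dimZ_apply (M : CatC F r m) (k : ZMod r) : dimZ M k = ∑ a, (M.X a).dimZ k :=
  Finsupp.finsetSum_apply _ _ _

variable [Field F]

/-- Degrees are at most 2, so three coefficients determine a morphism. -/
instance [Finite F] (V W : Vertex F r m) : Finite (V ⟶ W) := by
  refine Finite.of_injective (β := Fin 3 → F) (fun f d => f.1 d) fun f g h => ?_
  refine Subtype.ext (funext fun d => ?_)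
  by_cases hd : d < 3
  · exact congrFun h ⟨d, hd⟩
  · have hn : ¬ HasArrow V W d := fun hV => hd (by have := hV.le_two; omega)
    rw [f.2 d hn, g.2 d hn]

/-- The coefficient of the arrow of degree `d`. -/
def coeff {V W : Vertex F r m} (f : V ⟶ W) (d : ℕ) : F := f.1 d

theorem coeff_eq_zero {V W : Vertex F r m} (f : V ⟶ W) {d : ℕ} (h : ¬ HasArrow V W d) :
    coeff f d = 0 := f.2 d h

theorem coeff_arrow_self {V W : Vertex F r m} {d : ℕ} (h : HasArrow V W d) :
    coeff (arrow h) d = 1 := Pi.single_eq_same (M := fun _ => F) d 1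

theorem arrow_ne_zero {V W : Vertex F r m} {d : ℕ} (h : HasArrow V W d) : arrow h ≠ 0 := fun h0 =>
  one_ne_zero ((coeff_arrow_self h).symm.trans (congrArg (coeff · d) h0))

theorem eq_smul_arrow {V W : Vertex F r m} {d : ℕ} (h : HasArrow V W d)
    (hd : ∀ e, HasArrow V W e → e = d) (f : V ⟶ W) : f = coeff f d • arrow h := by
  classical
  refine Subtype.ext (funext fun e => ?_)
  change coeff f e = coeff f d * (Pi.single d 1 : ℕ → F) e
  by_cases he : e = d
  · subst he
    simp
  · rw [Pi.single_eq_of_ne he, mul_zero]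
    exact coeff_eq_zero f fun hV => he (hd e hV)

theorem hom_eq_zero {V W : Vertex F r m} (h : ∀ e, ¬ HasArrow V W e) (f : V ⟶ W) : f = 0 :=
  Subtype.ext (funext fun e => f.2 e (h e))

open Classical in
/-- The morphisms that are killed by `v` when all the arrows `V ⟶ W` have degree `d`. -/
theorem card_ker_rightComp_vertex {V W W' : Vertex F r m} (v : W ⟶ W') (d : ℕ)
    (hd : ∀ e, HasArrow V W e → e = d) :
    Nat.card (Preadditive.rightComp V v).ker =
      Nat.card F ^ (if ∃ h : HasArrow V W d, arrow h ≫ v = 0 then 1 else 0) := by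
  split_ifs with h
  · obtain ⟨h, hv⟩ := h
    rw [pow_one]
    refine Nat.card_congr
      { toFun := fun f => coeff f.1 d
        invFun := fun c => ⟨c • arrow h, ?_⟩
        left_inv := fun f => Subtype.ext (eq_smul_arrow h hd f.1).symm
        right_inv := fun c => ?_ }
    · change (c • arrow h) ≫ v = 0
      rw [Linear.smul_comp, hv, smul_zero]
    · change c * coeff (arrow h) d = c
      rw [coeff_arrow_self, mul_one]
  · rw [pow_zero, Nat.card_eq_one_iff_unique]
    refine ⟨⟨fun f g => ?_⟩, ⟨0⟩⟩
    suffices H : ∀ f : (Preadditive.rightComp V v).ker, f = 0 by rw [H f, H g]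
    rintro ⟨f, hf⟩
    refine Subtype.ext ?_
    by_cases hV : HasArrow V W d
    · have hc := eq_smul_arrow hV hd f
      have hv : coeff f d • (arrow hV ≫ v) = 0 := by
        rw [← Linear.smul_comp, ← hc]
        exact hf
      change f = 0
      rw [hc]
      rcases smul_eq_zero.1 hv with h0 | h0
      · rw [h0, zero_smul]
      · exact absurd ⟨hV, h0⟩ h
    · exact hom_eq_zero (fun e he => hV (hd e he ▸ he)) f

open Classical in
theorem card_hom_vertex {V W : Vertex F r m} (d : ℕ) (hd : ∀ e, HasArrow V W e → e = d) :
    Nat.card (V ⟶ W) = Nat.card F ^ (if HasArrow V W d then 1 else 0) := by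
  -- For v = 0 the kernel is the whole morphism space.
  have h := card_ker_rightComp_vertex (V := V) (0 : W ⟶ W) d hd
  rw [show (Preadditive.rightComp V (0 : W ⟶ W)).ker = ⊤ from
    top_unique fun f _ => show f ≫ 0 = 0 from comp_zero,
    Nat.card_congr AddSubgroup.topEquiv.toEquiv] at h
  simpa using h

/-- As δ_{k,1} m ≥ 0 > i, the second alternative in `dimXEntry` is void; what remains is the
condition for an arrow V → Z_i^{(k)}. -/
theorem card_hom_Z_of_neg (V : Vertex F r m) (k : ZMod r) {i : ℤ} (hi : i < 0) :
    Nat.card (V ⟶ .Z k i) = Nat.card F ^ V.dimXEntry (k, i) := by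
  have := deltaOne_nonneg (m := m) k
  rw [card_hom_vertex V.degToZ fun _ h => h.eq_degToZ]
  congr 1
  cases V <;> simp only [Vertex.degToZ, HasArrow, Vertex.dimXEntry] <;> congr 1 <;> grind

/-- The source index is chosen so that adding δ_{k-1,r} m - 1 = δ_{k,1} m - 1, as in the arrows Z →
X, gives back i. -/
theorem card_Z_hom_of_le (V : Vertex F r m) (k : ZMod r) {i : ℤ} (hi : deltaOne m k ≤ i) :
    Nat.card (Vertex.Z (k - 1) (i - deltaOne m k + 1) ⟶ V) =
      Nat.card F ^ V.dimXEntry (k, i) := by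
  have := deltaOne_nonneg (m := m) k
  rw [card_hom_vertex V.degFromZ fun _ h => h.eq_degFromZ]
  congr 1
  cases V <;> simp only [Vertex.degFromZ, HasArrow, Vertex.dimXEntry, deltaR_sub_one] <;>
    congr 1 <;> grind

theorem eventually_card_hom_Z (V : Vertex F r m) (k : ZMod r) :
    ∀ᶠ j : ℤ in Filter.atTop, Nat.card (V ⟶ .Z k j) = Nat.card F ^ V.dimZ k := by
  cases V with
  | X l s t h =>
    filter_upwards [Filter.eventually_gt_atTop t] with j hj
    rw [card_hom_vertex _ fun _ h => h.eq_degToZ]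
    simp only [Vertex.degToZ, HasArrow, Vertex.dimZ, Finsupp.coe_zero, Pi.zero_apply]
    rw [if_neg (by omega)]
  | Z l s =>
    filter_upwards [Filter.eventually_ge_atTop s] with j hj
    rw [card_hom_vertex _ fun _ h => h.eq_degToZ]
    simp [Vertex.degToZ, HasArrow, Vertex.dimZ, Finsupp.single_apply, hj, eq_comm]

-- On X_{s,t} the composite with Z_i → Z_j vanishes once j > t, so every morphism to Z_i is in the
-- kernel. On Z_s the composite Z_s → Z_i → Z_j is again an arrow, so the kernel is zero, as is the
-- entry for 0 ≤ i < δ_{k,1} m.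
open Classical in
theorem eventually_card_ker_arrow (V : Vertex F r m) (k : ZMod r) {i : ℤ} (hi : 0 ≤ i)
    (hi' : i < deltaOne m k) :
    ∀ᶠ j : ℤ in Filter.atTop, ∀ hij : i ≤ j,
      Nat.card (Preadditive.rightComp V (arrow (hasArrow_Z_Z (F := F) (m := m) (k := k) hij))).ker =
        Nat.card F ^ V.dimXEntry (k, i) := by
  cases V with
  | X l s t h =>
    filter_upwards [Filter.eventually_gt_atTop t] with j hj hij
    rw [card_ker_rightComp_vertex _ 1 fun _ hV => HasArrow.eq_degToZ (V := .X l s t h) hV]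
    congr 1
    simp only [Vertex.dimXEntry, arrow_comp_arrow]
    congr 1
    rw [eq_iff_iff]
    constructor
    · rintro ⟨h, -⟩
      exact ⟨h.1.symm, h.2⟩
    · rintro ⟨h₁, h₂⟩
      refine ⟨⟨h₁.symm, h₂⟩, dif_neg fun h' => ?_⟩
      exact absurd h'.2.2 (by omega)
  | Z l s =>
    filter_upwards [Filter.eventually_ge_atTop s] with j hj hij
    rw [card_ker_rightComp_vertex _ 0 fun _ hV => HasArrow.eq_degToZ (V := .Z l s) hV]
    simp only [Vertex.dimXEntry, arrow_comp_arrow]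
    rw [if_neg, if_neg (by omega)]
    rintro ⟨h₁, h₂⟩
    rw [dif_pos (show HasArrow (Vertex.Z l s) (Vertex.Z k j) (0 + 0) from ⟨h₁.1, hj⟩)] at h₂
    exact arrow_ne_zero _ h₂

/-! ### Entries of dimension vectors as exponents: objects -/

theorem card_hom_objZ_of_neg (M : CatC F r m) (k : ZMod r) {i : ℤ} (hi : i < 0) :
    Nat.card (M ⟶ objZ F m k i) = Nat.card F ^ dimX M (k, i) := by
  rw [Mat_.card_hom_embedding, dimX_apply, ← Finset.prod_pow_eq_pow_sum]
  exact Finset.prod_congr rfl fun a _ => card_hom_Z_of_neg _ k hi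

theorem card_objZ_hom_of_le (M : CatC F r m) (k : ZMod r) {i : ℤ} (hi : deltaOne m k ≤ i) :
    Nat.card (objZ F m (k - 1) (i - deltaOne m k + 1) ⟶ M) = Nat.card F ^ dimX M (k, i) := by
  rw [Mat_.card_embedding_hom, dimX_apply, ← Finset.prod_pow_eq_pow_sum]
  exact Finset.prod_congr rfl fun a _ => card_Z_hom_of_le _ k hi

theorem eventually_card_hom_objZ (M : CatC F r m) (k : ZMod r) :
    ∀ᶠ j : ℤ in Filter.atTop, Nat.card (M ⟶ objZ F m k j) = Nat.card F ^ dimZ M k := by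
  filter_upwards [Filter.eventually_all.2 fun a => eventually_card_hom_Z (M.X a) k] with j hj
  rw [Mat_.card_hom_embedding, dimZ_apply, ← Finset.prod_pow_eq_pow_sum]
  exact Finset.prod_congr rfl fun a _ => hj a

theorem eventually_card_ker_objZ (M : CatC F r m) (k : ZMod r) {i : ℤ} (hi : 0 ≤ i)
    (hi' : i < deltaOne m k) :
    ∀ᶠ j : ℤ in Filter.atTop, ∀ hij : i ≤ j, Nat.card (Preadditive.rightComp M
      ((Mat_.embedding _).map (arrow (hasArrow_Z_Z (k := k) hij)))).ker =
        Nat.card F ^ dimX M (k, i) := by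
  filter_upwards [Filter.eventually_all.2 fun a =>
    eventually_card_ker_arrow (M.X a) k hi hi'] with j hj hij
  rw [Mat_.card_ker_rightComp_embedding, dimX_apply, ← Finset.prod_pow_eq_pow_sum]
  exact Finset.prod_congr rfl fun a _ => hj a hij

theorem dimZ_eq_zero_iff (M : CatC F r m) : dimZ M = 0 ↔ catX F r m M := by
  rw [dimZ, Finset.sum_eq_zero_iff]
  refine ⟨fun h a => ?_, fun h a _ => ?_⟩
  · have ha := h a (Finset.mem_univ a)
    cases hV : M.X a with
    | X k i j hij => exact ⟨k, i, j, hij, rfl⟩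
    | Z k i => simp [hV, Vertex.dimZ] at ha
  · obtain ⟨k, i, j, hij, hV⟩ := h a
    rw [hV, Vertex.dimZ]

/-- No vertex is a zero object: its identity is the arrow of degree 0, a basis element. -/
theorem isZero_iff_isEmpty (M : CatC F r m) : IsZero M ↔ IsEmpty M.ι := by
  rw [IsZero.iff_id_eq_zero]
  refine ⟨fun h => ⟨fun a => ?_⟩, fun h => Mat_.hom_ext _ _ fun a => h.elim a⟩
  have h₁ : (𝟙 (M.X a) : M.X a ⟶ M.X a) = 0 :=
    (Mat_.id_apply_self M a).symm.trans (congrFun (congrFun h a) a)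
  exact arrow_ne_zero (hasArrow_refl (M.X a)) h₁

theorem isZero_of_dimX_eq_zero {M : CatC F r m} (hM : catX F r m M) (h : dimX M = 0) :
    IsZero M := by
  rw [isZero_iff_isEmpty]
  refine ⟨fun a => ?_⟩
  obtain ⟨k, i, j, hij, hV⟩ := hM a
  -- A summand X_{i,j}^{(k)} contributes 1 at the left end i of its interval.
  have h₁ := congrArg (· (k, i)) h
  simp only [dimX_apply, Finsupp.coe_zero, Pi.zero_apply, Finset.sum_eq_zero_iff] at h₁
  have h₂ := h₁ a (Finset.mem_univ a)
  rw [hV] at h₂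
  simp [Vertex.dimXEntry, hij] at h₂

theorem dimX_of_isZero {M : CatC F r m} (h : IsZero M) : dimX M = 0 := by
  have := (isZero_iff_isEmpty M).1 h
  exact Finset.sum_of_isEmpty _

theorem dimZ_of_isZero {M : CatC F r m} (h : IsZero M) : dimZ M = 0 := by
  have := (isZero_iff_isEmpty M).1 h
  exact Finset.sum_of_isEmpty _

/-! ### The subcategory X(r, m): isomorphisms and shifts -/

section Finite

variable [Finite F]

theorem card_pow_le_iff {a b : ℕ} : Nat.card F ^ a ≤ Nat.card F ^ b ↔ a ≤ b :=
  Nat.pow_le_pow_iff_right Finite.one_lt_card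

/-- `catX` is defined through the list of summands. This description by morphisms is visibly
invariant under isomorphism and can be transported along the shift. -/
theorem catX_iff_eventually (M : CatC F r m) :
    catX F r m M ↔ ∀ k : ZMod r, ∀ᶠ j : ℤ in Filter.atTop, ∀ f : M ⟶ objZ F m k j, f = 0 := by
  rw [← dimZ_eq_zero_iff, Finsupp.ext_iff]
  refine forall_congr' fun k => ?_
  have hone : ∀ j, (∀ f : M ⟶ objZ F m k j, f = 0) ↔ Nat.card (M ⟶ objZ F m k j) ≤ 1 := fun j => by
    rw [Finite.card_le_one_iff_subsingleton]
    exact ⟨fun h => ⟨fun f g => (h f).trans (h g).symm⟩, fun h f => Subsingleton.elim _ _⟩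
  simp only [hone]
  rw [Filter.eventually_congr (q := fun _ => dimZ M k = 0)
    ((eventually_card_hom_objZ M k).mono fun j hj => ?_)]
  · exact Filter.eventually_const.symm
  · rw [hj, ← pow_zero (Nat.card F), card_pow_le_iff, Nat.le_zero]

instance : (catX F r m).IsClosedUnderIsomorphisms where
  of_iso e h := by
    rw [catX_iff_eventually] at h ⊢
    intro k
    filter_upwards [h k] with j hj f
    rw [← cancel_epi e.hom, hj (e.hom ≫ f), comp_zero]

variable [HasShift (CatC F r m) ℤ] [∀ n : ℤ, (shiftFunctor (CatC F r m) n).Additive]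

/-- A morphism from ΣM to Z_j^{(k)} is the suspension of one from M to Z_{j-δ}^{(k-1)} with δ =
δ_{k-1,r} m, and j - δ tends to infinity with j. -/
theorem catX_shift_one (hshift : IsStandardShift F r m) {M : CatC F r m} (hM : catX F r m M) :
    catX F r m (M⟦(1 : ℤ)⟧) := by
  rw [catX_iff_eventually] at hM ⊢
  intro k
  have htendsto := Filter.tendsto_atTop_add_const_right Filter.atTop (-deltaR m (k - 1))
    (Filter.tendsto_id (α := ℤ))
  filter_upwards [htendsto.eventually (hM (k - 1))] with j hj f
  obtain ⟨e⟩ := hshift.2 (k - 1) (j + -deltaR m (k - 1))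
  have hobj : objZ F m (k - 1 + 1) (j + -deltaR m (k - 1) + deltaR m (k - 1)) = objZ F m k j := by
    congr 2 <;> ring
  obtain ⟨g, hg⟩ := (shiftFunctor (CatC F r m) (1 : ℤ)).map_surjective
    (f ≫ (e ≪≫ eqToIso hobj).inv)
  rw [← cancel_mono (e ≪≫ eqToIso hobj).inv, ← hg, hj g, Functor.map_zero, zero_comp]

theorem catX_shift_neg_one (hshift : IsStandardShift F r m) {M : CatC F r m}
    (hM : catX F r m M) : catX F r m (M⟦(-1 : ℤ)⟧) := by
  rw [catX_iff_eventually] at hM ⊢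
  intro k
  have htendsto := Filter.tendsto_atTop_add_const_right Filter.atTop (deltaR m k)
    (Filter.tendsto_id (α := ℤ))
  filter_upwards [htendsto.eventually (hM (k + 1))] with j hj f
  obtain ⟨e⟩ := hshift.2 k j
  apply (shiftFunctor (CatC F r m) (1 : ℤ)).map_injective
  -- Through M ≅ ΣΣ⁻¹M and ΣZ_j^{(k)} ≅ Z_{j+δ}^{(k+1)}, with δ = δ_{k,r} m, the suspension of f
  -- becomes a morphism from M, to which `hj` applies.
  rw [Functor.map_zero, ← cancel_mono e.hom,
    ← cancel_epi ((shiftFunctorCompIsoId (CatC F r m) (-1 : ℤ) 1 (by simp)).inv.app M)]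
  exact (hj _).trans (by rw [zero_comp, comp_zero])

theorem catX_isStableUnderShift (hshift : IsStandardShift F r m) :
    (catX F r m).IsStableUnderShift ℤ where
  isStableUnderShiftBy n := ⟨fun M hM => by
    change catX F r m (M⟦n⟧)
    induction n using Int.induction_on with
    | zero => exact (catX F r m).prop_of_iso ((shiftFunctorZero _ ℤ).symm.app M) hM
    | succ n ih =>
      exact (catX F r m).prop_of_iso ((shiftFunctorAdd' _ (n : ℤ) 1 _ rfl).symm.app M)
        (catX_shift_one hshift ih)
    | pred n ih =>
      exact (catX F r m).prop_of_iso ((shiftFunctorAdd' _ (-n : ℤ) (-1) _ rfl).symm.app M)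
        (catX_shift_neg_one hshift ih)⟩

/-! ### Subadditivity along triangles -/

variable [Pretriangulated (CatC F r m)]

theorem dimZ_le_add (T : Triangle (CatC F r m)) (hT : T ∈ distTriang (CatC F r m)) :
    dimZ T.obj₂ ≤ dimZ T.obj₁ + dimZ T.obj₃ := fun k => by
  -- One j large enough for all three objects.
  obtain ⟨j, h₁, h₂, h₃⟩ := ((eventually_card_hom_objZ T.obj₁ k).and
    ((eventually_card_hom_objZ T.obj₂ k).and (eventually_card_hom_objZ T.obj₃ k))).exists
  have h := (card_hom_to_le T hT (objZ F m k j)).1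
  rwa [h₁, h₂, h₃, ← pow_add, card_pow_le_iff, add_comm] at h

/-- The hypothesis `hZ` matters only in the gap 0 ≤ i < δ_{k,1} m, where the entry counts a kernel
instead of a full morphism space. -/
theorem dimX_le_add (T : Triangle (CatC F r m)) (hT : T ∈ distTriang (CatC F r m))
    (hZ : dimZ T.obj₂ = dimZ T.obj₁ + dimZ T.obj₃) :
    dimX T.obj₂ ≤ dimX T.obj₁ + dimX T.obj₃ := by
  rintro ⟨k, i⟩
  rw [Finsupp.add_apply]
  rcases lt_or_ge i 0 with hi | hi
  · have h := (card_hom_to_le T hT (objZ F m k i)).1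
    simp only [card_hom_objZ_of_neg _ k hi] at h
    rwa [← pow_add, card_pow_le_iff, add_comm] at h
  rcases le_or_gt (deltaOne m k) i with hi' | hi'
  · have h := card_hom_from_le T hT (objZ F m (k - 1) (i - deltaOne m k + 1))
    simp only [card_objZ_hom_of_le _ k hi'] at h
    rwa [← pow_add, card_pow_le_iff] at h
  · obtain ⟨j, hij, h₁, h₂, h₃, h₁', h₂', h₃'⟩ := ((Filter.eventually_ge_atTop i).and
      ((eventually_card_hom_objZ T.obj₁ k).and ((eventually_card_hom_objZ T.obj₂ k).and
      ((eventually_card_hom_objZ T.obj₃ k).and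
      ((eventually_card_ker_objZ T.obj₁ k hi hi').and
      ((eventually_card_ker_objZ T.obj₂ k hi hi').and
        (eventually_card_ker_objZ T.obj₃ k hi hi'))))))).exists
    have h := card_ker_rightComp_le T hT ((Mat_.embedding _).map (arrow (hasArrow_Z_Z (k := k) hij)))
      -- Equality of the `dimZ` vectors makes the count for Z_j^{(k)} sharp, so composition with
      -- T.mor₂ is injective on morphisms to it.
      ((card_hom_to_le T hT (objZ F m k j)).2 (by
        rw [h₁, h₂, h₃, ← pow_add, hZ, Finsupp.add_apply, add_comm]))
    rwa [h₁' hij, h₂' hij, h₃' hij, ← pow_add, card_pow_le_iff, add_comm] at h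

theorem isSubadditivePair_dimZ_dimX :
    IsSubadditivePair (T := CatC F r m) dimZ dimX where
  eq_zero_iff M := by
    rw [Prod.mk_eq_zero]
    exact ⟨fun h => isZero_of_dimX_eq_zero ((dimZ_eq_zero_iff M).1 h.1) h.2,
      fun h => ⟨dimZ_of_isZero h, dimX_of_isZero h⟩⟩
  le_add T hT := (dimZ_le_add T hT).lt_or_eq.imp id fun h => ⟨h, dimX_le_add T hT h⟩

theorem catX_isTriangulated (hshift : IsStandardShift F r m) : (catX F r m).IsTriangulated where
  exists_zero := (HasZeroObject.zero (C := CatC F r m)).imp fun _ hM =>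
    ⟨hM, (dimZ_eq_zero_iff _).1 (dimZ_of_isZero hM)⟩
  toIsStableUnderShift := catX_isStableUnderShift hshift
  -- Membership is the vanishing of `dimZ`, which passes to the middle term by subadditivity.
  toIsTriangulatedClosed₂ := .mk' fun T hT h₁ h₃ => by
    rw [← dimZ_eq_zero_iff] at h₁ h₃ ⊢
    simpa [h₁, h₃] using dimZ_le_add T hT

theorem isSubadditive_dimX [(catX F r m).IsTriangulated] :
    IsSubadditive (T := (catX F r m).FullSubcategory) (fun M => dimX M.obj) where
  eq_zero_iff M := by
    have hM : IsZero M ↔ IsZero M.obj :=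
      ⟨fun h => (catX F r m).ι.map_isZero h,
        fun h => IsZero.of_full_of_faithful_of_isZero (catX F r m).ι M h⟩
    rw [hM]
    exact ⟨isZero_of_dimX_eq_zero M.property, dimX_of_isZero⟩
  le_add T hT := by
    -- On X(r, m) all `dimZ` vectors vanish, so the required equality is 0 = 0 + 0.
    refine dimX_le_add _ ((catX F r m).ι.map_distinguished T hT) ?_
    have hZ : ∀ M : (catX F r m).FullSubcategory, dimZ M.obj = 0 := fun M =>
      (dimZ_eq_zero_iff _).2 M.property
    exact (hZ T.obj₂).trans (by
      change 0 = dimZ T.obj₁.obj + dimZ T.obj₃.obj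
      rw [hZ, hZ, add_zero])

end Finite

end DiscreteDerived

theorem mainTheorem5 (F : Type u) [Field F] [Finite F] (r m : ℕ) (hr : 0 < r) (hm : 0 < m)
    [HasShift (DiscreteDerived.CatC F r m) ℤ]
    [∀ n : ℤ, (shiftFunctor (DiscreteDerived.CatC F r m) n).Additive]
    [Pretriangulated (DiscreteDerived.CatC F r m)]
    [IsTriangulated (DiscreteDerived.CatC F r m)]
    (hshift : DiscreteDerived.IsStandardShift F r m) :
    DiscreteDerived.IsSubadditivePair (T := DiscreteDerived.CatC F r m)
        DiscreteDerived.dimZ DiscreteDerived.dimX ∧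
      ∃ _ : (DiscreteDerived.catX F r m).IsTriangulated,
        DiscreteDerived.IsSubadditive (T := (DiscreteDerived.catX F r m).FullSubcategory)
          (fun M => DiscreteDerived.dimX M.obj) := by
  have := DiscreteDerived.catX_isTriangulated hshift
  exact ⟨DiscreteDerived.isSubadditivePair_dimZ_dimX, this, DiscreteDerived.isSubadditive_dimX⟩
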